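/- **Theorem.** For a sequence $a=(a_n)_{n\ge 0}$ and an integer $k\ge 1$ let $$M_n^{(k)}(a)=\sum_{\substack{j_1,\dots,j_k\ge 0\\ j_1+\dots+j_k=n}} a_{j_1}\cdots a_{j_k}$$ be its $k$-fold convolution. Let $a_n=\binom{2n}{n}^3$. Then for each fixed integer $k\ge 1$, $$M_n^{(k)}(a)\;\sim\;\frac{64^n}{(n\pi)^{3/2}}\left(\frac{\pi}{\Gamma(3/4)^4}\right)^{k-1}k\qquad(n\to\infty).$$ For $n\ge 1$, a simple random walk bridge of length $2n$ is an integer path $(x_0,x_1,\dots,x_{2n})$ with steps $\pm1$ and $x_0=x_{2n}=0$. Let $\mathbf P_n$ be the law of three independent bridges $x^{(1)},x^{(2)},x^{(3)}$, each uniformly distributed on the set of simple random walk bridges of length $2n$, and let $$Z_n=\{0\}\cup\{t\in\{1,\dots,n\}: x^{(1)}_{2t}=x^{(2)}_{2t}=x^{(3)}_{2t}=0\}.$$ Put $p=\Gamma(3/4)^4/\pi$. Then $0<p<1$, and for each fixed integer $k\ge 2$, $$\lim_{n\to\infty}\mathbf P_n(|Z_n|=k)=(k-1)(1-p)^{k-2}p^2,$$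 so the limiting probabilities are those of the negative binomial law with parameters $(2,p)$. -/

import Mathlib

open Filter Topology Asymptotics MeasureTheory

/-- The `k`-fold convolution of a sequence `a` at `n`:
the sum of `a (j 0) * ⋯ * a (j (k - 1))` over all `j : Fin k → ℕ` with
`j 0 + ⋯ + j (k - 1) = n`. -/
def multiConv (k : ℕ) (a : ℕ → ℝ) (n : ℕ) : ℝ :=
  ∑ j ∈ Finset.piAntidiag (Finset.univ : Finset (Fin k)) n, ∏ i, a (j i)

/-- The set of simple random walk bridges `(x 0, x 1, …, x (2 * n))` of length `2 * n`:
integer paths with steps `± 1` and `x 0 = x (2 * n) = 0`. -/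
def srwBridges (n : ℕ) : Set (Fin (2 * n + 1) → ℤ) :=
  {x | x 0 = 0 ∧ x (Fin.last (2 * n)) = 0 ∧
    ∀ i : Fin (2 * n), |x i.succ - x i.castSucc| = 1}

/-- The uniform probability measure on the simple random walk bridges of length `2 * n`. -/
noncomputable def srwBridgeMeasure (n : ℕ) : Measure (Fin (2 * n + 1) → ℤ) :=
  ProbabilityTheory.uniformOn (srwBridges n)

/-- The law of three independent uniformly distributed simple random walk bridges
of length `2 * n`. -/
noncomputable def threeBridgeMeasure (n : ℕ) : Measure (Fin 3 → Fin (2 * n + 1) → ℤ) :=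
  Measure.pi fun _ => srwBridgeMeasure n

/-- The set of `t ∈ {0, …, n}` such that `t = 0` or all three paths are at the origin
at time `2 * t`. -/
def commonZeros {n : ℕ} (x : Fin 3 → Fin (2 * n + 1) → ℤ) : Finset (Fin (n + 1)) :=
  {t | t = 0 ∨ ∀ i, x i ⟨2 * (t : ℕ), by omega⟩ = 0}

/-!
Write `c n = (2 * n).choose n / 4 ^ n` (`returnProb`), so that `64 ^ n * c n ^ 3` is the cube of the
central binomial coefficient, and let `S = ∑ c n ^ 3`.

*The value of `S`.* The series is the case `a = 1 / 2` of the well-poised series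
`₃F₂(a, 1/2, 1/2; a + 1/2, a + 1/2; 1)`, which Dixon's theorem sums. A Wilf–Zeilberger pair
(`dixonTerm_sub_ratio_mul`) relates the sums at `a` and `a + 2` by an explicit rational factor. As
`a` tends to infinity the sum tends to `1`, so `S` is the infinite product of these factors, which
Euler's formula for `Γ(3/4)` and Wallis' product evaluate to `π / Γ(3/4) ^ 4`
(`tsum_returnProb_cube`).

*Convolutions.* By Wallis, `c n ^ 3` is asymptotic to `(π n) ^ (-3/2)`. In a convolution of summable
sequences with such tails one index is bounded and the other one is large
(`IsRegularWeight.tendsto_seqConv`); by induction the `k`-th convolution power is asymptotic to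
`k S ^ (k - 1) (π n) ^ (-3/2)`, which is the first claim.

*Common zeros.* Decomposing walks in `ℤ ^ 3` at their first return to `0` (`visitSum_eq`) shows that
the probability of `k` returns, the last one at time `2 * n`, is the `k`-th convolution power of the
first-return law `f` (`visitCount_div`), and that `c n ^ 3` satisfies the renewal equation with
waiting-time law `f`. Hence `∑ f = 1 - 1 / S`. Since `S < 2`, the renewal equation is an asymptotic
contraction for the tail of `f`, which gives `f n ∼ c n ^ 3 / S ^ 2`
(`IsRegularWeight.tendsto_of_renewal`). The tail of the convolution powers of `f`, divided by
`c n ^ 3`, is then the negative binomial law with `p = 1 / S`.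
-/

/-! ### Return probabilities -/

/-- The probability that a simple random walk is at the origin at time `2 * n`. -/
noncomputable def returnProb (n : ℕ) : ℝ := (n.centralBinom : ℝ) / 4 ^ n

lemma returnProb_pos (n : ℕ) : 0 < returnProb n := by
  have := n.centralBinom_pos
  unfold returnProb
  positivity

@[simp] lemma returnProb_zero : returnProb 0 = 1 := by simp [returnProb]

lemma returnProb_succ (n : ℕ) :
    returnProb (n + 1) = returnProb n * ((2 * n + 1) / (2 * n + 2)) := by
  have h := congrArg (Nat.cast (R := ℝ)) (Nat.succ_mul_centralBinom_succ n)
  push_cast at h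
  unfold returnProb
  rw [pow_succ]
  field_simp
  linear_combination 2 * h

lemma sq_returnProb_mul_wallis (n : ℕ) :
    returnProb n ^ 2 * (2 * n + 1) * Real.Wallis.W n = 1 := by
  induction n with
  | zero => simp [Real.Wallis.W]
  | succ n ih =>
    rw [returnProb_succ, Real.Wallis.W_succ]
    push_cast
    refine Eq.trans ?_ ih
    field_simp
    ring

lemma sq_returnProb_le (n : ℕ) : returnProb n ^ 2 ≤ 1 / (2 * n + 1) := by
  induction n with
  | zero => simp
  | succ n ih =>
    rw [returnProb_succ, mul_pow]
    calc _ ≤ 1 / (2 * (n : ℝ) + 1) * ((2 * n + 1) / (2 * n + 2)) ^ 2 := by gcongr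
      _ ≤ _ := by
        push_cast
        rw [div_pow, div_mul_div_comm, div_le_div_iff₀ (by positivity) (by positivity)]
        nlinarith [(Nat.cast_nonneg n : (0 : ℝ) ≤ n)]

/-- A telescoping majorant, sharp enough to give `∑ returnProb n ^ 3 < 2`. -/
lemma returnProb_cube_succ_le (n : ℕ) :
    returnProb (n + 1) ^ 3 ≤ returnProb n - returnProb (n + 1) := by
  have h := sq_returnProb_le (n + 1)
  have h0 := returnProb_pos n
  calc returnProb (n + 1) ^ 3 = returnProb (n + 1) * returnProb (n + 1) ^ 2 := by ring
    _ ≤ returnProb (n + 1) * (1 / (2 * (n + 1 : ℕ) + 1)) := by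
        gcongr
        exact (returnProb_pos _).le
    _ ≤ _ := by
        rw [returnProb_succ]
        have : returnProb n - returnProb n * ((2 * n + 1) / (2 * n + 2))
            - returnProb n * ((2 * n + 1) / (2 * n + 2)) * (1 / (2 * (n + 1 : ℕ) + 1)) =
            returnProb n * (2 / ((2 * n + 2) * (2 * n + 3))) := by
          push_cast
          field_simp
          ring
        have h2 : 0 ≤ returnProb n * (2 / ((2 * (n : ℝ) + 2) * (2 * n + 3))) := by positivity
        linarith

lemma sum_returnProb_cube_le (n : ℕ) :
    ∑ k ∈ Finset.range n, returnProb (k + 2) ^ 3 ≤ 1 / 2 := by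
  have h : ∑ k ∈ Finset.range n, returnProb (k + 2) ^ 3 ≤ returnProb 1 - returnProb (n + 1) := by
    rw [← Finset.sum_range_sub' (fun k => returnProb (k + 1))]
    exact Finset.sum_le_sum fun k _ => returnProb_cube_succ_le (k + 1)
  have h1 : returnProb 1 = 1 / 2 := by rw [returnProb_succ]; norm_num
  linarith [returnProb_pos (n + 1)]

lemma summable_returnProb_cube : Summable fun n => returnProb n ^ 3 := by
  rw [← summable_nat_add_iff 2]
  exact summable_of_sum_range_le (fun n => pow_nonneg (returnProb_pos _).le 3)
    sum_returnProb_cube_le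

lemma one_lt_tsum_returnProb_cube : 1 < ∑' n, returnProb n ^ 3 := by
  have h := summable_returnProb_cube.sum_le_tsum (Finset.range 2)
    fun n _ => pow_nonneg (returnProb_pos _).le 3
  have h1 : returnProb 1 = 1 / 2 := by rw [returnProb_succ]; norm_num
  rw [Finset.sum_range_succ, Finset.sum_range_one, h1] at h
  norm_num at h
  linarith

lemma tsum_returnProb_cube_lt_two : ∑' n, returnProb n ^ 3 < 2 := by
  have h1 : returnProb 1 = 1 / 2 := by rw [returnProb_succ]; norm_num
  rw [← summable_returnProb_cube.sum_add_tsum_nat_add 2, Finset.sum_range_succ,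
    Finset.sum_range_one, h1]
  have := Real.tsum_le_of_sum_range_le (fun n => pow_nonneg (returnProb_pos (n + 2)).le 3)
    sum_returnProb_cube_le
  norm_num
  linarith

lemma tendsto_returnProb_mul_sqrt :
    Tendsto (fun n : ℕ => returnProb n * √(2 * n + 1)) atTop (𝓝 √(2 / Real.pi)) := by
  have h : Tendsto (fun n => √((Real.Wallis.W n)⁻¹)) atTop (𝓝 √((Real.pi / 2)⁻¹)) :=
    (Real.continuous_sqrt.tendsto _).comp
      (Real.Wallis.tendsto_W_nhds_pi_div_two.inv₀ (by positivity))
  rw [inv_div] at h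
  refine h.congr fun n => ?_
  rw [← eq_inv_of_mul_eq_one_left (sq_returnProb_mul_wallis n), Real.sqrt_mul (sq_nonneg _),
    Real.sqrt_sq (returnProb_pos n).le]

/-! ### A well-poised hypergeometric sum -/

/-- The term of index `k` of the well-poised series `₃F₂(a, 1/2, 1/2; a + 1/2, a + 1/2; 1)`. -/
noncomputable def dixonTerm (a : ℝ) (k : ℕ) : ℝ :=
  ∏ i ∈ Finset.range k, (a + i) * (i + 1 / 2) ^ 2 / ((i + 1) * (a + i + 1 / 2) ^ 2)

lemma dixonTerm_succ (a : ℝ) (k : ℕ) : dixonTerm a (k + 1) =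
    dixonTerm a k * ((a + k) * (k + 1 / 2) ^ 2 / ((k + 1) * (a + k + 1 / 2) ^ 2)) :=
  Finset.prod_range_succ _ _

lemma dixonTerm_half (k : ℕ) : dixonTerm (1 / 2) k = returnProb k ^ 3 := by
  induction k with
  | zero => simp [dixonTerm]
  | succ k ih =>
    rw [dixonTerm_succ, ih, returnProb_succ]
    field_simp
    ring

lemma dixonTerm_nonneg {a : ℝ} (ha : 0 ≤ a) (k : ℕ) : 0 ≤ dixonTerm a k :=
  Finset.prod_nonneg fun i _ => by positivity

/-- Each factor of `dixonTerm a k` is antitone in `a ≥ 1 / 2`, so that `a = 1 / 2` dominates. -/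
lemma dixonTerm_le {a : ℝ} (ha : 1 / 2 ≤ a) (k : ℕ) : dixonTerm a k ≤ returnProb k ^ 3 := by
  rw [← dixonTerm_half]
  have ha0 : 0 < a := by linarith
  refine Finset.prod_le_prod (fun i _ => by positivity) fun i _ => ?_
  rw [div_le_div_iff₀ (by positivity) (by positivity), ← sub_nonneg]
  have : (1 / 2 + (i : ℝ)) * (i + 1 / 2) ^ 2 * ((i + 1) * (a + i + 1 / 2) ^ 2) -
      (a + i) * (i + 1 / 2) ^ 2 * ((i + 1) * (1 / 2 + i + 1 / 2) ^ 2) =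
      (i + 1 / 2) ^ 2 * (i + 1) * ((a - 1 / 2) * ((1 / 2 + i) * (a + i) - 1 / 4)) := by ring
  rw [this]
  have h : 0 ≤ (1 / 2 + (i : ℝ)) * (a + i) - 1 / 4 := by
    nlinarith [(Nat.cast_nonneg i : (0 : ℝ) ≤ i)]
  have h2 : 0 ≤ a - 1 / 2 := by linarith
  positivity

lemma summable_dixonTerm {a : ℝ} (ha : 1 / 2 ≤ a) : Summable (dixonTerm a) :=
  .of_nonneg_of_le (dixonTerm_nonneg (by linarith)) (dixonTerm_le ha) summable_returnProb_cube

lemma dixonTerm_add_two {a : ℝ} (ha : 0 < a) (k : ℕ) : dixonTerm (a + 2) k = dixonTerm a k *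
    ((a + k) * (a + k + 1) / (a * (a + 1)) *
      ((a + 1 / 2) * (a + 3 / 2) / ((a + k + 1 / 2) * (a + k + 3 / 2))) ^ 2) := by
  induction k with
  | zero =>
    simp only [dixonTerm, Finset.range_zero, Finset.prod_empty, Nat.cast_zero, add_zero]
    field_simp
  | succ k ih =>
    rw [dixonTerm_succ, dixonTerm_succ, ih]
    push_cast
    field_simp
    ring

/-- The ratio of the sums of the well-poised series at `a` and at `a + 2`. -/
noncomputable def dixonRatio (a : ℝ) : ℝ := ((a + 1) ^ 2 / ((a + 1 / 2) * (a + 3 / 2))) ^ 2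

/-- The Wilf–Zeilberger companion of `dixonTerm`. -/
noncomputable def dixonCompanion (a : ℝ) (k : ℕ) : ℝ :=
  dixonTerm a k * (k * (k ^ 2 + (3 * a + 1) * k + 2 * a ^ 2 + a - 1 / 4) /
    (a * (a + k + 1 / 2) ^ 2))

/-- The Wilf–Zeilberger relation between the series at `a` and at `a + 2`. -/
lemma dixonTerm_sub_ratio_mul {a : ℝ} (ha : 0 < a) (k : ℕ) :
    dixonTerm a k - dixonRatio a * dixonTerm (a + 2) k =
      dixonCompanion a k - dixonCompanion a (k + 1) := by
  rw [dixonCompanion, dixonCompanion, dixonTerm_add_two ha, dixonTerm_succ, dixonRatio]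
  push_cast
  field_simp
  ring

lemma tendsto_dixonCompanion {a : ℝ} (ha : 1 / 2 ≤ a) :
    Tendsto (dixonCompanion a) atTop (𝓝 0) := by
  have ha0 : 0 < a := by linarith
  have h1 : Tendsto (fun k : ℕ => returnProb k * (3 / a)) atTop (𝓝 0) := by
    have h : Tendsto (fun k : ℕ => returnProb k) atTop (𝓝 0) := by
      have := (summable_returnProb_cube.tendsto_atTop_zero).rpow_const (p := 1 / 3)
        (Or.inr (by norm_num))
      rw [Real.zero_rpow (by norm_num)] at this
      refine this.congr fun n => ?_
      rw [← Real.rpow_natCast, ← Real.rpow_mul (returnProb_pos n).le]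
      norm_num
    simpa using h.mul_const (3 / a)
  refine squeeze_zero (fun k => ?_) (fun k => ?_) h1
  · have := dixonTerm_nonneg ha0.le k
    have : 0 ≤ (k : ℝ) ^ 2 + (3 * a + 1) * k + 2 * a ^ 2 + a - 1 / 4 := by
      have : 0 ≤ (k : ℝ) ^ 2 + (3 * a + 1) * k + 2 * a ^ 2 := by positivity
      linarith
    unfold dixonCompanion
    positivity
  · have hk : (0 : ℝ) ≤ k := Nat.cast_nonneg k
    have hp := returnProb_pos k
    have h2 : (k ^ 2 + (3 * a + 1) * k + 2 * a ^ 2 + a - 1 / 4) / (a * (a + k + 1 / 2) ^ 2)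
        ≤ 3 / a := by
      rw [div_le_div_iff₀ (by positivity) ha0]
      nlinarith [mul_nonneg hk ha0.le, mul_nonneg (mul_nonneg hk hk) ha0.le,
        mul_nonneg (mul_nonneg hk ha0.le) ha0.le, pow_pos ha0 3, pow_pos ha0 2]
    calc dixonCompanion a k = dixonTerm a k * k *
          ((k ^ 2 + (3 * a + 1) * k + 2 * a ^ 2 + a - 1 / 4) / (a * (a + k + 1 / 2) ^ 2)) := by
          unfold dixonCompanion; ring
      _ ≤ returnProb k ^ 3 * k * (3 / a) := by
          refine (mul_le_mul_of_nonneg_left h2 ?_).trans ?_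
          · exact mul_nonneg (dixonTerm_nonneg ha0.le k) hk
          · gcongr
            exact dixonTerm_le ha k
      _ = returnProb k * (returnProb k ^ 2 * k) * (3 / a) := by ring
      _ ≤ returnProb k * 1 * (3 / a) := by
          gcongr
          have h3 := sq_returnProb_le k
          rw [le_div_iff₀ (by positivity)] at h3
          nlinarith [sq_nonneg (returnProb k)]
      _ = _ := by ring

lemma tsum_dixonTerm_add_two {a : ℝ} (ha : 1 / 2 ≤ a) :
    ∑' k, dixonTerm a k = dixonRatio a * ∑' k, dixonTerm (a + 2) k := by
  have ha2 : 1 / 2 ≤ a + 2 := by linarith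
  have hs := (summable_dixonTerm ha).sub ((summable_dixonTerm ha2).mul_left (dixonRatio a))
  have h := hs.hasSum.tendsto_sum_nat
  have h0 : Tendsto (fun n => ∑ k ∈ Finset.range n,
      (dixonTerm a k - dixonRatio a * dixonTerm (a + 2) k)) atTop (𝓝 0) := by
    have : Tendsto (fun n => dixonCompanion a 0 - dixonCompanion a n) atTop (𝓝 0) := by
      simpa [dixonCompanion] using (tendsto_dixonCompanion ha).const_sub (dixonCompanion a 0)
    refine this.congr fun n => ?_
    rw [← Finset.sum_range_sub' (dixonCompanion a)]
    exact Finset.sum_congr rfl fun k _ => (dixonTerm_sub_ratio_mul (by linarith) k).symm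
  have := tendsto_nhds_unique h h0
  rw [(summable_dixonTerm ha).tsum_sub ((summable_dixonTerm ha2).mul_left _), tsum_mul_left] at this
  linarith

/-- Only the term of index `0` survives as the parameter tends to infinity. -/
lemma tendsto_tsum_dixonTerm :
    Tendsto (fun m : ℕ => ∑' k, dixonTerm (1 / 2 + 2 * m) k) atTop (𝓝 1) := by
  have h : Tendsto (fun m : ℕ => ∑' k, dixonTerm (1 / 2 + 2 * m) k) atTop
      (𝓝 (∑' k, if k = 0 then (1 : ℝ) else 0)) := by
    refine tendsto_tsum_of_dominated_convergence summable_returnProb_cube (fun k => ?_)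
      (.of_forall fun m k => ?_)
    · have hfac (i : ℕ) : Tendsto (fun m : ℕ => (1 / 2 + 2 * (m : ℝ) + i) * (i + 1 / 2) ^ 2 /
          ((i + 1) * (1 / 2 + 2 * (m : ℝ) + i + 1 / 2) ^ 2)) atTop (𝓝 0) := by
        have h1 : Tendsto (fun m : ℕ => ((i : ℝ) + 1 / 2) ^ 2 / (m : ℝ)) atTop (𝓝 0) :=
          tendsto_const_nhds.div_atTop tendsto_natCast_atTop_atTop
        refine squeeze_zero' (.of_forall fun m => by positivity) ?_ h1
        filter_upwards [eventually_gt_atTop 0] with m hm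
        have hm' : (0 : ℝ) < m := by exact_mod_cast hm
        have hi : (0 : ℝ) ≤ i := Nat.cast_nonneg i
        rw [div_le_div_iff₀ (by positivity) hm']
        have h2 : (1 / 2 + 2 * (m : ℝ) + i) * m ≤
            (i + 1) * (1 / 2 + 2 * (m : ℝ) + i + 1 / 2) ^ 2 := by
          have h3 : (1 / 2 + 2 * (m : ℝ) + i) * m ≤ (1 / 2 + 2 * (m : ℝ) + i + 1 / 2) ^ 2 := by
            rw [sq]
            exact mul_le_mul (by linarith) (by linarith) hm'.le (by positivity)
          nlinarith [mul_nonneg hi (sq_nonneg (1 / 2 + 2 * (m : ℝ) + i + 1 / 2))]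
        nlinarith [mul_le_mul_of_nonneg_left h2 (sq_nonneg ((i : ℝ) + 1 / 2))]
      rcases k with _ | k
      · simp [dixonTerm]
      · have := tendsto_finsetProd (Finset.range (k + 1)) fun i _ => hfac i
        simpa [dixonTerm] using this
    · rw [Real.norm_of_nonneg (dixonTerm_nonneg (by positivity) k)]
      exact dixonTerm_le (by linarith [(Nat.cast_nonneg m : (0 : ℝ) ≤ m)]) k
  simpa using h

lemma tsum_returnProb_cube_eq_prod_mul (m : ℕ) : ∑' k, returnProb k ^ 3 =
    (∏ j ∈ Finset.range m, dixonRatio (1 / 2 + 2 * j)) *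
      ∑' k, dixonTerm (1 / 2 + 2 * m) k := by
  induction m with
  | zero => simp [← dixonTerm_half]
  | succ m ih =>
    rw [ih, Finset.prod_range_succ, tsum_dixonTerm_add_two (a := 1 / 2 + 2 * m)
      (by linarith [(Nat.cast_nonneg m : (0 : ℝ) ≤ m)]), mul_assoc]
    push_cast
    ring_nf

/-- The product in terms of quantities with known asymptotics: the product on the right belongs to
Euler's sequence for `Γ(3/4)`. -/
lemma prod_dixonRatio (m : ℕ) : ∏ j ∈ Finset.range (m + 1), dixonRatio (1 / 2 + 2 * j) =
    (4 * ((∏ j ∈ Finset.range (m + 1), (3 / 4 + (j : ℝ))) / m.factorial) ^ 2 /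
      (returnProb m * (2 * m + 1) * (2 * m + 2))) ^ 2 := by
  induction m with
  | zero => norm_num [dixonRatio]
  | succ m ih =>
    have := returnProb_pos m
    rw [Finset.prod_range_succ, ih, Finset.prod_range_succ _ (m + 1), returnProb_succ, dixonRatio,
      Nat.factorial_succ, ← mul_pow]
    congr 1
    push_cast
    field_simp
    ring

lemma tendsto_prod_dixonRatio :
    Tendsto (fun m : ℕ => ∏ j ∈ Finset.range m, dixonRatio (1 / 2 + 2 * j)) atTop
      (𝓝 (Real.pi / Real.Gamma (3 / 4) ^ 4)) := by
  rw [← tendsto_add_atTop_iff_nat 1]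
  have hΓ : 0 < Real.Gamma (3 / 4) := Real.Gamma_pos_of_pos (by norm_num)
  have hinv : Tendsto (fun m : ℕ => (m : ℝ)⁻¹) atTop (𝓝 0) := tendsto_inv_atTop_nhds_zero_nat
  have h1 : Tendsto (fun m : ℕ => (m : ℝ) / (2 * m + 2)) atTop (𝓝 (1 / 2)) := by
    have : Tendsto (fun m : ℕ => 1 / (2 + 2 * (m : ℝ)⁻¹)) atTop (𝓝 (1 / (2 + 2 * 0))) :=
      tendsto_const_nhds.div ((hinv.const_mul 2).const_add 2) (by norm_num)
    rw [mul_zero, add_zero] at this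
    refine this.congr' ?_
    filter_upwards [eventually_gt_atTop 0] with m hm
    have : (m : ℝ) ≠ 0 := by positivity
    field_simp
  have h2 : Tendsto (fun m : ℕ => √((m : ℝ) / (2 * m + 1))) atTop (𝓝 √(1 / 2)) := by
    refine (Real.continuous_sqrt.tendsto _).comp ?_
    have : Tendsto (fun m : ℕ => 1 / (2 + (m : ℝ)⁻¹)) atTop (𝓝 (1 / (2 + 0))) :=
      tendsto_const_nhds.div (hinv.const_add 2) (by norm_num)
    rw [add_zero] at this
    refine this.congr' ?_
    filter_upwards [eventually_gt_atTop 0] with m hm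
    have : (m : ℝ) ≠ 0 := by positivity
    field_simp
  have h3 := (((h1.mul h2).const_mul 4).div (((Real.GammaSeq_tendsto_Gamma (3 / 4)).pow 2).mul
    tendsto_returnProb_mul_sqrt) (by positivity)).pow 2
  have hlim : (4 * (1 / 2 * √(1 / 2)) / (Real.Gamma (3 / 4) ^ 2 * √(2 / Real.pi))) ^ 2 =
      Real.pi / Real.Gamma (3 / 4) ^ 4 := by
    rw [div_pow, mul_pow, mul_pow, mul_pow, Real.sq_sqrt (by norm_num),
      Real.sq_sqrt (by positivity)]
    field_simp
    norm_num
  rw [hlim] at h3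
  refine h3.congr' ?_
  filter_upwards [eventually_gt_atTop 0] with m hm
  have hm0 : (0 : ℝ) < m := by exact_mod_cast hm
  have hc := returnProb_pos m
  have hP : 0 < ∏ j ∈ Finset.range (m + 1), (3 / 4 + (j : ℝ)) :=
    Finset.prod_pos fun j _ => by positivity
  have hpow : ((m : ℝ) ^ (3 / 4 : ℝ)) ^ 2 = m * √m := by
    rw [← Real.rpow_natCast, ← Real.rpow_mul hm0.le, Real.sqrt_eq_rpow, ← Real.rpow_one_add' hm0.le
      (by norm_num)]
    norm_num
  have hs : √(2 * (m : ℝ) + 1) ^ 2 = 2 * m + 1 := Real.sq_sqrt (by positivity)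
  have hs0 : 0 < √(2 * (m : ℝ) + 1) := Real.sqrt_pos.2 (by positivity)
  have hsm : 0 < √(m : ℝ) := Real.sqrt_pos.2 hm0
  rw [prod_dixonRatio, Pi.div_apply]
  congr 1
  rw [Real.GammaSeq, Real.sqrt_div hm0.le, div_pow, mul_pow, hpow]
  generalize √(2 * (m : ℝ) + 1) = r at hs hs0 ⊢
  field_simp
  linear_combination -hs

/-- The sum `₃F₂(1/2, 1/2, 1/2; 1, 1; 1)`, a special case of Dixon's theorem. -/
theorem tsum_returnProb_cube : ∑' n, returnProb n ^ 3 = Real.pi / Real.Gamma (3 / 4) ^ 4 := by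
  have h := tendsto_prod_dixonRatio.mul tendsto_tsum_dixonTerm
  rw [mul_one] at h
  exact tendsto_nhds_unique (tendsto_const_nhds.congr tsum_returnProb_cube_eq_prod_mul) h

/-! ### Convolutions of sequences with a regular tail -/

/-- A positive weight `w` such that `w (n - j)` is asymptotic to `w n` for each fixed `j`, and is
`O(w n)` uniformly in `j ≤ n / 2`. -/
structure IsRegularWeight (w : ℕ → ℝ) : Prop where
  pos (n : ℕ) : 0 < w n
  tendsto_shift (j : ℕ) : Tendsto (fun n => w (n - j) / w n) atTop (𝓝 1)
  exists_le : ∃ C, ∀ n j, 2 * j ≤ n → w (n - j) ≤ C * w n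

/-- The convolution of two sequences. -/
def seqConv (u v : ℕ → ℝ) (n : ℕ) : ℝ := ∑ p ∈ Finset.HasAntidiagonal.antidiagonal n, u p.1 * v p.2

/-- Both halves are written so that the summation index is the smaller of the two; the diagonal term
goes to the second half. -/
lemma seqConv_eq_sum_lower_add_sum_upper (u v : ℕ → ℝ) (n : ℕ) : seqConv u v n =
    ∑ j ∈ Finset.range (n + 1) with 2 * j < n, u j * v (n - j) +
      ∑ j ∈ Finset.range (n + 1) with 2 * j ≤ n, v j * u (n - j) := by
  rw [seqConv, Finset.Nat.sum_antidiagonal_eq_sum_range_succ (fun i j => u i * v j),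
    ← Finset.sum_filter_add_sum_filter_not _ (fun j => 2 * j < n)]
  congr 1
  refine Finset.sum_bij' (fun j _ => n - j) (fun j _ => n - j) ?_ ?_ ?_ ?_ ?_ <;>
    simp only [Finset.mem_filter, Finset.mem_range]
  · intro j hj; omega
  · intro j hj; omega
  · intro j hj; omega
  · intro j hj; omega
  · intro j hj
    rw [mul_comm, Nat.sub_sub_self (by omega)]

lemma hasSum_seqConv {u v : ℕ → ℝ} {U V : ℝ} (hu : HasSum u U) (hv : HasSum v V) :
    HasSum (seqConv u v) (U * V) := by
  rw [← hu.tsum_eq, ← hv.tsum_eq,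
    tsum_mul_tsum_eq_tsum_sum_antidiagonal_of_summable_norm hu.summable.norm hv.summable.norm]
  exact (summable_norm_sum_mul_antidiagonal_of_summable_norm
    hu.summable.norm hv.summable.norm).of_norm.hasSum

namespace IsRegularWeight

variable {w : ℕ → ℝ}

lemma exists_abs_le (hw : IsRegularWeight w) {v : ℕ → ℝ} {β : ℝ}
    (hv : Tendsto (fun n => v n / w n) atTop (𝓝 β)) : ∃ B, 0 ≤ B ∧ ∀ n, |v n| ≤ B * w n := by
  obtain ⟨B, hB⟩ := hv.abs.bddAbove_range
  refine ⟨B, (abs_nonneg _).trans (hB ⟨0, rfl⟩), fun n => ?_⟩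
  have := hB ⟨n, rfl⟩
  simp only [abs_div, abs_of_pos (hw.pos n)] at this
  rwa [div_le_iff₀ (hw.pos n)] at this

/-- Tannery's theorem for the half of a convolution in which the second index is large. -/
lemma tendsto_sum_half (hw : IsRegularWeight w) {u v : ℕ → ℝ} {U β : ℝ} (hu : HasSum u U)
    (hv : Tendsto (fun n => v n / w n) atTop (𝓝 β)) {s : ℕ → Finset ℕ}
    (hs : ∀ n, ∀ j ∈ s n, 2 * j ≤ n) (hs' : ∀ j, ∀ᶠ n in atTop, j ∈ s n) :
    Tendsto (fun n => (∑ j ∈ s n, u j * v (n - j)) / w n) atTop (𝓝 (U * β)) := by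
  obtain ⟨B, hB0, hB⟩ := hw.exists_abs_le hv
  obtain ⟨C, hC⟩ := hw.exists_le
  have hC0 : 0 ≤ C := by
    have := hC 0 0 le_rfl
    have h0 := hw.pos 0
    by_contra! h
    nlinarith
  have h : Tendsto (fun n => ∑' j, if j ∈ s n then u j * (v (n - j) / w n) else 0) atTop
      (𝓝 (∑' j, u j * β)) := by
    refine tendsto_tsum_of_dominated_convergence (bound := fun j => |u j| * (B * C))
      (hu.summable.abs.mul_right _) (fun j => ?_) (.of_forall fun n j => ?_)
    · have h1 : Tendsto (fun n => u j * (v (n - j) / w (n - j) * (w (n - j) / w n))) atTop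
          (𝓝 (u j * (β * 1))) :=
        ((hv.comp (tendsto_sub_atTop_nat j)).mul (hw.tendsto_shift j)).const_mul _
      rw [mul_one] at h1
      refine h1.congr' ?_
      filter_upwards [hs' j] with n hn
      rw [if_pos hn, div_mul_div_cancel₀ (hw.pos _).ne']
    · split_ifs with hj
      · rw [Real.norm_eq_abs, abs_mul, abs_div, abs_of_pos (hw.pos n)]
        gcongr
        rw [div_le_iff₀ (hw.pos n), mul_assoc]
        exact (hB _).trans (by gcongr; exact hC n j (hs n j hj))
      · simp only [norm_zero]
        positivity
  rw [tsum_mul_right, hu.tsum_eq] at h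
  refine h.congr fun n => ?_
  rw [tsum_eq_sum (s := s n) fun j hj => if_neg hj, Finset.sum_div]
  exact Finset.sum_congr rfl fun j hj => by rw [if_pos hj, mul_div_assoc]

lemma eventually_mem_lower (j : ℕ) :
    ∀ᶠ n in atTop, j ∈ (Finset.range (n + 1)).filter (fun j => 2 * j < n) := by
  filter_upwards [eventually_gt_atTop (2 * j)] with n hn
  simp only [Finset.mem_filter, Finset.mem_range]
  omega

lemma eventually_mem_upper (j : ℕ) :
    ∀ᶠ n in atTop, j ∈ (Finset.range (n + 1)).filter (fun j => 2 * j ≤ n) := by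
  filter_upwards [eventually_gt_atTop (2 * j)] with n hn
  simp only [Finset.mem_filter, Finset.mem_range]
  omega

/-- In a convolution of summable sequences with tails of order `w`, one index is bounded and the
other one carries the tail. -/
theorem tendsto_seqConv (hw : IsRegularWeight w) {u v : ℕ → ℝ} {U V α β : ℝ}
    (hu : HasSum u U) (hv : HasSum v V) (hα : Tendsto (fun n => u n / w n) atTop (𝓝 α))
    (hβ : Tendsto (fun n => v n / w n) atTop (𝓝 β)) :
    Tendsto (fun n => seqConv u v n / w n) atTop (𝓝 (U * β + V * α)) := by
  refine ((hw.tendsto_sum_half hu hβ ?_ eventually_mem_lower).add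
    (hw.tendsto_sum_half hv hα ?_ eventually_mem_upper)).congr fun n => ?_
  · intro n j hj
    exact (Finset.mem_filter.1 hj).2.le
  · intro n j hj
    exact (Finset.mem_filter.1 hj).2
  · rw [← add_div, ← seqConv_eq_sum_lower_add_sum_upper]

end IsRegularWeight

/-- The `k`-fold convolution power of a sequence. -/
def seqConvPow (u : ℕ → ℝ) : ℕ → ℕ → ℝ
  | 0 => fun n => if n = 0 then 1 else 0
  | k + 1 => seqConv u (seqConvPow u k)

lemma hasSum_seqConvPow {u : ℕ → ℝ} {U : ℝ} (hu : HasSum u U) (k : ℕ) :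
    HasSum (seqConvPow u k) (U ^ k) := by
  induction k with
  | zero => simpa [seqConvPow] using hasSum_ite_eq (0 : ℕ) (1 : ℝ)
  | succ k ih => simpa only [seqConvPow, pow_succ'] using hasSum_seqConv hu ih

namespace IsRegularWeight

variable {w : ℕ → ℝ}

/-- In a convolution power, one of the `k` indices carries the tail. For `k = 0` the junk value of
`k - 1` is harmless, since the limit has the factor `k`. -/
theorem tendsto_seqConvPow (hw : IsRegularWeight w) {u : ℕ → ℝ} {U α : ℝ}
    (hu : HasSum u U) (hα : Tendsto (fun n => u n / w n) atTop (𝓝 α)) (k : ℕ) :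
    Tendsto (fun n => seqConvPow u k n / w n) atTop (𝓝 (k * U ^ (k - 1) * α)) := by
  induction k with
  | zero =>
    simp only [Nat.cast_zero, zero_mul]
    refine tendsto_const_nhds.congr' ?_
    filter_upwards [eventually_gt_atTop 0] with n hn
    simp [seqConvPow, hn.ne']
  | succ k ih =>
    convert! hw.tendsto_seqConv hu (hasSum_seqConvPow hu k) hα ih using 2
    rcases k with _ | k
    · simp
    · push_cast
      simp only [pow_succ]
      ring

/-- The tail of the waiting-time law `f` of a renewal sequence `b`. The error `f / w - κ / S ^ 2`
is asymptotically reduced by the factor `S - 1 < 1` at each use of the renewal equation. -/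
theorem tendsto_of_renewal (hw : IsRegularWeight w) {b f : ℕ → ℝ} {S κ : ℝ} (hb0 : b 0 = 1)
    (hb : ∀ n, 0 ≤ b n) (hbS : HasSum b S) (hS : S < 2)
    (hκ : Tendsto (fun n => b n / w n) atTop (𝓝 κ)) (hf0 : f 0 = 0) (hf : ∀ n, 0 ≤ f n)
    (hfb : ∀ n, f n ≤ b n) (hren : ∀ n, 0 < n → b n = seqConv f b n) :
    HasSum f (1 - 1 / S) ∧ Tendsto (fun n => f n / w n) atTop (𝓝 (κ / S ^ 2)) := by
  have hS1 : 1 ≤ S := by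
    have := hbS.summable.le_tsum 0 fun n _ => hb n
    rwa [hb0, hbS.tsum_eq] at this
  have hS0 : 0 < S := by linarith
  have hfs : Summable f := .of_nonneg_of_le hf hfb hbS.summable
  have hfF : HasSum f (1 - 1 / S) := by
    have h1 : HasSum b (∑' n, f n * S + 1) := by
      have h2 := (hasSum_seqConv hfs.hasSum hbS).add (hasSum_ite_eq (0 : ℕ) (1 : ℝ))
      rw [tsum_mul_right]
      refine h2.congr_fun ?_
      intro n
      rcases n with _ | n
      · simp [seqConv, hf0, hb0]
      · simp [hren (n + 1) n.succ_pos]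
    have h3 := hbS.unique h1
    rw [tsum_mul_right] at h3
    have h4 : ∑' n, f n = 1 - 1 / S := by
      field_simp
      linarith
    exact h4 ▸ hfs.hasSum
  refine ⟨hfF, ?_⟩
  set up : ℕ → Finset ℕ := fun n => {j ∈ Finset.range (n + 1) | 2 * j ≤ n} with hup
  have hupp : ∀ n, ∀ j ∈ up n, 2 * j ≤ n := fun n j hj => (Finset.mem_filter.1 hj).2
  set L := κ / S ^ 2 with hL
  set h : ℕ → ℝ := fun n => f n - L * w n with hh
  have hww : Tendsto (fun n => w n / w n) atTop (𝓝 1) :=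
    tendsto_const_nhds.congr fun n => (div_self (hw.pos n).ne').symm
  have hbw : Tendsto (fun n => (∑ j ∈ up n, b j * w (n - j)) / w n) atTop (𝓝 (S * 1)) :=
    hw.tendsto_sum_half hbS hww hupp IsRegularWeight.eventually_mem_upper
  -- In the renewal equation, the half with small waiting time contributes `κ * (1 - 1 / S)`.
  have hbf : Tendsto (fun n => (∑ j ∈ up n, b j * f (n - j)) / w n) atTop (𝓝 (κ / S)) := by
    have h1 := hκ.sub (hw.tendsto_sum_half hfF hκ
      (s := fun n => {j ∈ Finset.range (n + 1) | 2 * j < n})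
      (fun n j hj => (Finset.mem_filter.1 hj).2.le) IsRegularWeight.eventually_mem_lower)
    have h2 : κ - (1 - 1 / S) * κ = κ / S := by ring
    rw [h2] at h1
    refine h1.congr' ?_
    filter_upwards [eventually_gt_atTop 0] with n hn
    rw [hren n hn, seqConv_eq_sum_lower_add_sum_upper, ← sub_div, add_sub_cancel_left]
  have hbh : Tendsto (fun n => (∑ j ∈ up n, b j * h (n - j)) / w n) atTop (𝓝 0) := by
    have h1 := hbf.sub (hbw.const_mul L)
    have h2 : κ / S - L * (S * 1) = 0 := by
      rw [hL]; field_simp; ring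
    rw [h2] at h1
    refine h1.congr fun n => ?_
    rw [← mul_div_assoc, ← sub_div, Finset.mul_sum, ← Finset.sum_sub_distrib]
    congr 1
    exact Finset.sum_congr rfl fun j _ => by simp only [hh]; ring
  have hmem0 (n : ℕ) : 0 ∈ up n := by simp [hup]
  -- One application of the renewal equation contracts an asymptotic bound on the error.
  have hstep : ∀ c, 0 < c → (∀ᶠ n in atTop, |h n| ≤ c * w n) →
      ∀ᶠ n in atTop, |h n| ≤ c * (S / 2) * w n := by
    intro c hc hev
    obtain ⟨N, hN⟩ := eventually_atTop.1 hev
    have hδ : 0 < c * (1 - S / 2) / 2 := by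
      have : 0 < 1 - S / 2 := by linarith
      positivity
    have he1 := (hbh.abs.eventually_lt_const (u := c * (1 - S / 2) / 2) (by simpa using hδ))
    have he2 := ((hbw.const_mul c).eventually_lt_const
      (u := c * S + c * (1 - S / 2) / 2) (by linarith))
    filter_upwards [he1, he2, eventually_ge_atTop (2 * N)] with n h1 h2 hn
    have hwn := hw.pos n
    rw [abs_div, abs_of_pos hwn, div_lt_iff₀ hwn] at h1
    rw [← mul_div_assoc, div_lt_iff₀ hwn] at h2
    rw [← Finset.add_sum_erase _ _ (hmem0 n), hb0, one_mul, Nat.sub_zero] at h1 h2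
    have h3 : |∑ j ∈ (up n).erase 0, b j * h (n - j)| ≤
        c * ∑ j ∈ (up n).erase 0, b j * w (n - j) := by
      rw [Finset.mul_sum]
      refine (Finset.abs_sum_le_sum_abs _ _).trans (Finset.sum_le_sum fun j hj => ?_)
      rw [abs_mul, abs_of_nonneg (hb j), mul_left_comm]
      have := hupp n j (Finset.mem_of_mem_erase hj)
      exact mul_le_mul_of_nonneg_left (hN _ (by omega)) (hb j)
    have h4 : |h n| ≤ |h n + ∑ j ∈ (up n).erase 0, b j * h (n - j)| +
        |∑ j ∈ (up n).erase 0, b j * h (n - j)| := by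
      simpa using abs_sub (h n + ∑ j ∈ (up n).erase 0, b j * h (n - j))
        (∑ j ∈ (up n).erase 0, b j * h (n - j))
    nlinarith
  have hhlim : Tendsto (fun n => h n / w n) atTop (𝓝 0) := by
    obtain ⟨B, hB0, hB⟩ := hw.exists_abs_le hκ
    have hfB (n : ℕ) : |h n| ≤ (B + |L| + 1) * w n := by
      have h1 := (le_abs_self _).trans (hB n)
      have h2 := hfb n
      have h3 := hf n
      have hwn := hw.pos n
      calc |h n| ≤ |f n| + |L * w n| := abs_sub _ _
        _ = f n + |L| * w n := by rw [abs_mul, abs_of_nonneg h3, abs_of_pos hwn]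
        _ ≤ _ := by nlinarith
    have hk (k : ℕ) : ∀ᶠ n in atTop, |h n| ≤ (B + |L| + 1) * (S / 2) ^ k * w n := by
      induction k with
      | zero => exact .of_forall fun n => by simpa using hfB n
      | succ k ih =>
        rw [pow_succ, ← mul_assoc]
        exact hstep _ (by positivity) ih
    rw [Metric.tendsto_atTop']
    intro ε hε
    have hpow : Tendsto (fun k => (B + |L| + 1) * (S / 2) ^ k) atTop (𝓝 0) := by
      simpa using (tendsto_pow_atTop_nhds_zero_of_lt_one (by positivity)
        (by linarith : S / 2 < 1)).const_mul (B + |L| + 1)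
    obtain ⟨k, hk'⟩ := (hpow.eventually_lt_const hε).exists
    obtain ⟨N, hN⟩ := eventually_atTop.1 (hk k)
    refine ⟨N, fun n hn => ?_⟩
    rw [Real.dist_eq, sub_zero, abs_div, abs_of_pos (hw.pos n), div_lt_iff₀ (hw.pos n)]
    exact (hN n hn.le).trans_lt (mul_lt_mul_of_pos_right hk' (hw.pos n))
  have := hhlim.add_const L
  rw [zero_add] at this
  refine this.congr fun n => ?_
  have := (hw.pos n).ne'
  simp only [hh]
  field_simp
  ring

end IsRegularWeight

/-- The weight `(n + 1) ^ (-3 / 2)`. -/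
noncomputable def cubicWeight (n : ℕ) : ℝ := 1 / (√(n + 1)) ^ 3

lemma isRegularWeight_cubicWeight : IsRegularWeight cubicWeight where
  pos n := by
    have : 0 < √((n : ℝ) + 1) := Real.sqrt_pos.2 (by positivity)
    unfold cubicWeight
    positivity
  tendsto_shift j := by
    have h0 : Tendsto (fun n : ℕ => 1 + (j : ℝ) / ((n - j : ℕ) + 1)) atTop (𝓝 (1 + 0)) :=
      (tendsto_const_nhds.div_atTop (tendsto_atTop_add_const_right _ _
        (tendsto_natCast_atTop_atTop.comp (tendsto_sub_atTop_nat j)))).const_add 1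
    have h1 := ((Real.continuous_sqrt.tendsto _).comp h0).pow 3
    simp only [add_zero, Real.sqrt_one, one_pow] at h1
    refine h1.congr' ?_
    filter_upwards [eventually_ge_atTop j] with n hn
    have h2 : 1 + (j : ℝ) / ((n - j : ℕ) + 1) = (n + 1) / ((n - j : ℕ) + 1) := by
      rw [Nat.cast_sub hn]
      have : (n : ℝ) - j + 1 ≠ 0 := by
        have : (j : ℝ) ≤ n := by exact_mod_cast hn
        linarith
      field_simp
      ring
    simp only [Function.comp_apply]
    rw [h2, Real.sqrt_div (by positivity), cubicWeight, cubicWeight, div_pow]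
    field_simp
  exists_le := by
    refine ⟨√2 ^ 3, fun n j hj => ?_⟩
    have h1 : 0 < √((n : ℝ) + 1) := Real.sqrt_pos.2 (by positivity)
    have h2 : 0 < √(((n - j : ℕ) : ℝ) + 1) := Real.sqrt_pos.2 (by positivity)
    rw [cubicWeight, cubicWeight, mul_one_div, div_le_div_iff₀ (by positivity) (by positivity),
      one_mul, ← mul_pow, ← Real.sqrt_mul (by norm_num)]
    gcongr
    have : ((n : ℕ) : ℝ) ≤ ((2 * (n - j) : ℕ) : ℝ) := by exact_mod_cast (by omega)
    push_cast at this
    linarith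

lemma tendsto_returnProb_cube_div :
    Tendsto (fun n => returnProb n ^ 3 / cubicWeight n) atTop (𝓝 ((√Real.pi ^ 3)⁻¹)) := by
  have hinv : Tendsto (fun m : ℕ => (m : ℝ)⁻¹) atTop (𝓝 0) := tendsto_inv_atTop_nhds_zero_nat
  have h1 : Tendsto (fun n : ℕ => √(((n : ℝ) + 1) / (2 * n + 1))) atTop (𝓝 √(1 / 2)) := by
    refine (Real.continuous_sqrt.tendsto _).comp ?_
    have : Tendsto (fun m : ℕ => (1 + (m : ℝ)⁻¹) / (2 + (m : ℝ)⁻¹)) atTop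
        (𝓝 ((1 + 0) / (2 + 0))) :=
      (hinv.const_add 1).div (hinv.const_add 2) (by norm_num)
    simp only [add_zero] at this
    refine this.congr' ?_
    filter_upwards [eventually_gt_atTop 0] with m hm
    have : (m : ℝ) ≠ 0 := by positivity
    field_simp
  have h2 := (tendsto_returnProb_mul_sqrt.mul h1).pow 3
  rw [← Real.sqrt_mul (by positivity)] at h2
  have h3 : √(2 / Real.pi * (1 / 2)) = (√Real.pi)⁻¹ := by
    rw [← Real.sqrt_inv]
    congr 1
    field_simp
  rw [h3, inv_pow] at h2
  refine h2.congr fun n => ?_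
  have h4 : 0 < √(2 * (n : ℝ) + 1) := Real.sqrt_pos.2 (by positivity)
  rw [Real.sqrt_div (by positivity), cubicWeight]
  field_simp

lemma hasSum_returnProb_cube :
    HasSum (fun n => returnProb n ^ 3) (Real.pi / Real.Gamma (3 / 4) ^ 4) :=
  tsum_returnProb_cube ▸ summable_returnProb_cube.hasSum

/-! ### The asymptotics of the convolution powers -/

lemma multiConv_zero (a : ℕ → ℝ) : multiConv 0 a = seqConvPow a 0 := by
  ext n
  rw [multiConv, Finset.univ_eq_empty, Finset.piAntidiag_empty]
  split_ifs with h <;> simp [seqConvPow, h]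

lemma multiConv_succ (k : ℕ) (a : ℕ → ℝ) :
    multiConv (k + 1) a = seqConv a (multiConv k a) := by
  ext n
  simp only [multiConv, seqConv, Finset.mul_sum]
  rw [Finset.sum_sigma']
  refine Finset.sum_bij' (fun j _ => ⟨(j 0, ∑ i : Fin k, j i.succ), Fin.tail j⟩)
    (fun x _ => Fin.cons x.1.1 x.2) ?_ ?_ ?_ ?_ ?_
  · intro j hj
    simp only [Finset.mem_piAntidiag, Fin.sum_univ_succ] at hj
    simp only [Finset.mem_sigma, Finset.HasAntidiagonal.mem_antidiagonal, Finset.mem_piAntidiag,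
      Finset.mem_univ, implies_true, and_true]
    exact ⟨hj.1, rfl⟩
  · rintro ⟨⟨p, q⟩, x⟩ hx
    simp only [Finset.mem_sigma, Finset.HasAntidiagonal.mem_antidiagonal,
      Finset.mem_piAntidiag] at hx
    simp [Fin.sum_univ_succ, hx.2.1, hx.1]
  · intro j hj
    exact Fin.cons_self_tail j
  · rintro ⟨⟨p, q⟩, x⟩ hx
    simp only [Finset.mem_sigma, Finset.HasAntidiagonal.mem_antidiagonal,
      Finset.mem_piAntidiag] at hx
    simp [hx.2.1]
  · intro j hj
    simp [Fin.prod_univ_succ, Fin.tail]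

lemma multiConv_eq_seqConvPow (k : ℕ) (a : ℕ → ℝ) : multiConv k a = seqConvPow a k := by
  induction k with
  | zero => exact multiConv_zero a
  | succ k ih => rw [multiConv_succ, ih]; rfl

lemma seqConvPow_pow_mul (c : ℝ) (u : ℕ → ℝ) (k n : ℕ) :
    seqConvPow (fun n => c ^ n * u n) k n = c ^ n * seqConvPow u k n := by
  induction k generalizing n with
  | zero => rcases n with _ | n <;> simp [seqConvPow]
  | succ k ih =>
    simp only [seqConvPow, seqConv, Finset.mul_sum]
    refine Finset.sum_congr rfl fun p hp => ?_
    rw [ih, ← Finset.HasAntidiagonal.mem_antidiagonal.1 hp, pow_add]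
    ring

lemma choose_cube_eq (n : ℕ) :
    (((2 * n).choose n : ℕ) : ℝ) ^ 3 = 64 ^ n * returnProb n ^ 3 := by
  rw [returnProb, Nat.centralBinom_eq_two_mul_choose, div_pow, ← pow_mul, mul_comm n 3, pow_mul]
  norm_num
  field_simp

theorem multiConv_choose_cube_isEquivalent {k : ℕ} (hk : 1 ≤ k) :
    (fun n : ℕ => multiConv k (fun j => (((2 * j).choose j : ℕ) : ℝ) ^ 3) n) ~[atTop]
      fun n : ℕ => (64 : ℝ) ^ n / ((n : ℝ) * Real.pi) ^ (3 / 2 : ℝ) *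
        (Real.pi / Real.Gamma (3 / 4) ^ 4) ^ (k - 1) * (k : ℝ) := by
  have hΓ : 0 < Real.Gamma (3 / 4) := Real.Gamma_pos_of_pos (by norm_num)
  set S := Real.pi / Real.Gamma (3 / 4) ^ 4 with hS
  have hS0 : 0 < S := by positivity
  have hk0 : (0 : ℝ) < k := by exact_mod_cast hk
  have hpi : 0 < √Real.pi := Real.sqrt_pos.2 Real.pi_pos
  refine isEquivalent_of_tendsto_one ?_
  have h1 := isRegularWeight_cubicWeight.tendsto_seqConvPow hasSum_returnProb_cube
    tendsto_returnProb_cube_div k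
  have h2 : Tendsto (fun n : ℕ => √((n : ℝ) / (n + 1)) ^ 3) atTop (𝓝 1) := by
    simpa [Function.comp_def] using ((Real.continuous_sqrt.tendsto _).comp
      (tendsto_natCast_div_add_atTop (1 : ℝ))).pow 3
  have h3 := (h1.mul h2).const_mul ((√Real.pi) ^ 3 / (S ^ (k - 1) * k))
  have h4 : (√Real.pi) ^ 3 / (S ^ (k - 1) * k) * (k * S ^ (k - 1) * (√Real.pi ^ 3)⁻¹ * 1) = 1 := by
    field_simp
  rw [h4] at h3
  refine h3.congr' ?_
  filter_upwards [eventually_gt_atTop 0] with n hn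
  have hn0 : (0 : ℝ) < n := by exact_mod_cast hn
  have h5 : ((n : ℝ) * Real.pi) ^ (3 / 2 : ℝ) = (√n * √Real.pi) ^ 3 := by
    rw [← Real.sqrt_mul hn0.le, Real.sqrt_eq_rpow, ← Real.rpow_natCast, ← Real.rpow_mul
      (by positivity)]
    norm_num
  have h6 : 0 < √((n : ℝ) + 1) := Real.sqrt_pos.2 (by positivity)
  have h7 : 0 < √(n : ℝ) := Real.sqrt_pos.2 hn0
  simp only [Pi.div_apply, multiConv_eq_seqConvPow, choose_cube_eq]
  rw [seqConvPow_pow_mul, h5, Real.sqrt_div hn0.le, cubicWeight]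
  field_simp

/-! ### Walks and the first-passage decomposition -/

section Walks

variable {G : Type*} [AddCommGroup G] [DecidableEq G]

/-- The walks `(x 0, …, x m)` from `g` to `0` with steps in `D`, as functions on `Fin (m + 1)`. -/
def walksToZero (D : Finset G) : (m : ℕ) → G → Finset (Fin (m + 1) → G)
  | 0, g => if g = 0 then {fun _ => g} else ∅
  | m + 1, g => D.biUnion fun d => (walksToZero D m (g + d)).image (Fin.cons (α := fun _ => G) g)

lemma mem_walksToZero {D : Finset G} {m : ℕ} {g : G} {x : Fin (m + 1) → G} :
    x ∈ walksToZero D m g ↔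
      x 0 = g ∧ x (Fin.last m) = 0 ∧ ∀ i : Fin m, x i.succ - x i.castSucc ∈ D := by
  induction m generalizing g with
  | zero =>
    by_cases hg : g = 0
    · rw [walksToZero, if_pos hg, Finset.mem_singleton]
      constructor
      · rintro rfl
        exact ⟨rfl, hg, fun i => i.elim0⟩
      · rintro ⟨h0, -, -⟩
        funext i
        rw [← h0]
        congr 1
        ext
        omega
    · simp only [walksToZero, hg, if_false, Finset.notMem_empty, false_iff]
      rintro ⟨h0, h1, -⟩
      exact hg (h0 ▸ h1)
  | succ m ih =>
    simp only [walksToZero, Finset.mem_biUnion, Finset.mem_image]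
    constructor
    · rintro ⟨d, hd, y, hy, rfl⟩
      obtain ⟨h0, h1, h2⟩ := ih.1 hy
      refine ⟨rfl, ?_, fun i => ?_⟩
      · rw [← Fin.succ_last, Fin.cons_succ, h1]
      · refine Fin.cases ?_ (fun j => ?_) i
        · simpa [h0] using hd
        · rw [Fin.cons_succ, ← Fin.succ_castSucc, Fin.cons_succ]
          exact h2 j
    · rintro ⟨h0, h1, h2⟩
      refine ⟨x 1 - x 0, h2 0, Fin.tail x, ih.2 ⟨?_, ?_, fun i => ?_⟩, ?_⟩
      · rw [h0]
        simp [Fin.tail]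
      · exact h1
      · exact h2 i.succ
      · rw [← h0]
        exact Fin.cons_self_tail x

lemma sum_walksToZero_succ {M : Type*} [AddCommMonoid M] (D : Finset G) (m : ℕ) (g : G)
    (φ : (Fin (m + 2) → G) → M) : ∑ x ∈ walksToZero D (m + 1) g, φ x =
      ∑ d ∈ D, ∑ x ∈ walksToZero D m (g + d), φ (Fin.cons (α := fun _ => G) g x) := by
  rw [walksToZero, Finset.sum_biUnion]
  · exact Finset.sum_congr rfl fun d _ =>
      Finset.sum_image fun x _ y _ h => Fin.cons_right_injective (α := fun _ => G) g h
  · intro d _ e _ hde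
    rw [Function.onFun, Finset.disjoint_left]
    rintro _ hx hy
    obtain ⟨x, hx', rfl⟩ := Finset.mem_image.1 hx
    obtain ⟨y, hy', hxy⟩ := Finset.mem_image.1 hy
    have := Fin.cons_right_injective (α := fun _ => G) g hxy
    subst this
    exact hde (add_left_cancel ((mem_walksToZero.1 hx').1.symm.trans (mem_walksToZero.1 hy').1))

/-- The number of visits of a walk to `0`, the starting time excluded. -/
def visits {m : ℕ} (x : Fin (m + 1) → G) : ℕ := Finset.card {i : Fin m | x i.succ = 0}

lemma visits_cons {m : ℕ} (g : G) (x : Fin (m + 1) → G) :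
    visits (Fin.cons (α := fun _ => G) g x : Fin (m + 2) → G) =
      (if x 0 = 0 then 1 else 0) + visits x := by
  rw [visits, Fin.card_filter_univ_succ]
  simp only [Fin.cons_succ, visits]
  split_ifs <;> ring

/-- The generating function, in the number of visits to `0`, of the walks of length `m` from `g`
to `0`. -/
def visitSum {R : Type*} [CommSemiring R] (D : Finset G) (y : R) (m : ℕ) (g : G) : R :=
  ∑ x ∈ walksToZero D m g, y ^ visits x

/-- The number of walks of length `m` from `g` that are at `0` at time `m`, but at no time
in `{1, …, m - 1}`. By convention there are none for `m = 0`. -/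
def firstPassage (D : Finset G) : ℕ → G → ℕ
  | 0, _ => 0
  | m + 1, g => ∑ d ∈ D, if g + d = 0 then (if m = 0 then 1 else 0) else firstPassage D m (g + d)

variable {R : Type*} [CommSemiring R]

lemma visitSum_zero (D : Finset G) (y : R) (g : G) :
    visitSum D y 0 g = if g = 0 then 1 else 0 := by
  rw [visitSum, walksToZero]
  split_ifs <;> simp [visits]

lemma visitSum_succ (D : Finset G) (y : R) (m : ℕ) (g : G) : visitSum D y (m + 1) g =
    ∑ d ∈ D, if g + d = 0 then y * visitSum D y m 0 else visitSum D y m (g + d) := by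
  rw [visitSum, sum_walksToZero_succ]
  refine Finset.sum_congr rfl fun d _ => ?_
  split_ifs with h
  · rw [visitSum, Finset.mul_sum, h]
    refine Finset.sum_congr rfl fun x hx => ?_
    rw [visits_cons, if_pos (mem_walksToZero.1 hx).1, pow_add, pow_one]
  · refine Finset.sum_congr rfl fun x hx => ?_
    rw [visits_cons, (mem_walksToZero.1 hx).1, if_neg h, zero_add]

/-- Decomposition of the walks at their first visit to `0`. -/
theorem visitSum_eq (D : Finset G) (y : R) (m : ℕ) (g : G) : visitSum D y m g =
    (if m = 0 ∧ g = 0 then 1 else 0) + y * ∑ p ∈ Finset.HasAntidiagonal.antidiagonal m,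
      (firstPassage D p.1 g : R) * visitSum D y p.2 0 := by
  induction m generalizing g with
  | zero => simp [visitSum_zero, firstPassage]
  | succ m ih =>
    rw [visitSum_succ, Finset.Nat.sum_antidiagonal_succ]
    simp only [firstPassage, Nat.cast_zero, zero_mul, zero_add, Nat.succ_ne_zero, false_and,
      if_false, Nat.cast_sum, Finset.sum_mul]
    rw [Finset.sum_comm, Finset.mul_sum]
    refine Finset.sum_congr rfl fun d _ => ?_
    split_ifs with h
    · rw [Finset.sum_eq_single (0, m)]
      · simp
      · rintro ⟨i, j⟩ hp hne
        have : i ≠ 0 := by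
          rintro rfl
          simp at hp
          simp [hp] at hne
        simp [this]
      · simp
    · rw [ih, if_neg (by simp [h]), zero_add]

/-- The number of closed walks at `0` of length `m` with `k` visits to `0` after time `0`. -/
def visitCount (D : Finset G) (m k : ℕ) : ℕ :=
  Finset.card {x ∈ walksToZero D m 0 | visits x = k}

lemma coeff_visitSum (D : Finset G) (m k : ℕ) :
    (visitSum D (Polynomial.X : Polynomial ℕ) m 0).coeff k = visitCount D m k := by
  simp [visitSum, visitCount, Polynomial.finsetSum_coeff, Polynomial.coeff_X_pow, eq_comm]

lemma visitCount_zero_right (D : Finset G) (m : ℕ) :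
    visitCount D m 0 = if m = 0 then 1 else 0 := by
  rw [← coeff_visitSum, visitSum_eq]
  split_ifs <;> simp_all

lemma visitCount_succ (D : Finset G) (m k : ℕ) : visitCount D m (k + 1) =
    ∑ p ∈ Finset.HasAntidiagonal.antidiagonal m, firstPassage D p.1 0 * visitCount D p.2 k := by
  rw [← coeff_visitSum, visitSum_eq, Polynomial.coeff_add, Polynomial.coeff_X_mul]
  have : ((if m = 0 ∧ (0 : G) = 0 then 1 else 0 : Polynomial ℕ)).coeff (k + 1) = 0 := by
    split_ifs <;> simp [Polynomial.coeff_one]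
  rw [this, zero_add, Polynomial.finsetSum_coeff]
  refine Finset.sum_congr rfl fun p _ => ?_
  rw [← coeff_visitSum, Polynomial.coeff_natCast_mul, Nat.cast_id]

lemma card_walksToZero_eq (D : Finset G) {m : ℕ} (hm : 0 < m) : (walksToZero D m 0).card =
    ∑ p ∈ Finset.HasAntidiagonal.antidiagonal m,
      firstPassage D p.1 0 * (walksToZero D p.2 0).card := by
  simpa [visitSum, hm.ne'] using visitSum_eq D (1 : ℕ) m 0

lemma firstPassage_le (D : Finset G) (m : ℕ) :
    firstPassage D m 0 ≤ (walksToZero D m 0).card := by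
  rcases Nat.eq_zero_or_pos m with rfl | hm
  · simp [firstPassage]
  · rw [card_walksToZero_eq D hm]
    refine le_trans ?_ (Finset.single_le_sum (fun _ _ => Nat.zero_le _)
      (by simp : (m, 0) ∈ Finset.HasAntidiagonal.antidiagonal m))
    simp [walksToZero]

end Walks

/-! ### Simple random walk bridges -/

/-- The steps of the simple random walk on `ℤ`. -/
def srwSteps : Finset ℤ := {1, -1}

/-- The steps of three independent simple random walks on `ℤ`. -/
def tripleSteps : Finset (Fin 3 → ℤ) := Fintype.piFinset fun _ => srwSteps

lemma mem_srwSteps {z : ℤ} : z ∈ srwSteps ↔ |z| = 1 := by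
  rw [srwSteps, abs_eq zero_le_one]
  simp

lemma card_walksToZero_succ_srw (m : ℕ) (g : ℤ) : (walksToZero srwSteps (m + 1) g).card =
    (walksToZero srwSteps m (g + 1)).card + (walksToZero srwSteps m (g - 1)).card := by
  simp only [Finset.card_eq_sum_ones]
  rw [sum_walksToZero_succ, srwSteps, Finset.sum_pair (by norm_num), ← sub_eq_add_neg]

lemma card_walksToZero_srw_of_lt {m : ℕ} {g : ℤ} (h : (m : ℤ) < g) :
    (walksToZero srwSteps m g).card = 0 := by
  induction m generalizing g with
  | zero =>
    have : g ≠ 0 := by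
      push_cast at h
      omega
    simp [walksToZero, this]
  | succ m ih =>
    push_cast at h
    rw [card_walksToZero_succ_srw, ih (by omega), ih (by omega)]

/-- Pascal's rule, applied to the starting point `m - 2 * i`. -/
lemma card_walksToZero_srw (m i : ℕ) :
    (walksToZero srwSteps m ((m : ℤ) - 2 * i)).card = m.choose i := by
  induction m generalizing i with
  | zero => rcases i with _ | i <;> simp [walksToZero]; omega
  | succ m ih =>
    rw [card_walksToZero_succ_srw]
    rcases i with _ | i
    · rw [card_walksToZero_srw_of_lt (by push_cast; omega), zero_add]
      have := ih 0
      simp only [Nat.choose_zero_right] at this ⊢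
      refine Eq.trans ?_ this
      congr 2
      push_cast
      ring
    · rw [Nat.choose_succ_succ, ← ih i, ← ih (i + 1)]
      congr 3 <;> push_cast <;> ring

lemma coe_walksToZero_srw (n : ℕ) :
    (walksToZero srwSteps (2 * n) 0 : Set (Fin (2 * n + 1) → ℤ)) = srwBridges n := by
  ext x
  simp only [Finset.mem_coe, mem_walksToZero, srwBridges, Set.mem_ofPred_eq, mem_srwSteps]

/-- The triples of simple random walk bridges of length `2 * n`. -/
def tripleBridges (n : ℕ) : Finset (Fin 3 → Fin (2 * n + 1) → ℤ) :=
  Fintype.piFinset fun _ => walksToZero srwSteps (2 * n) 0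

lemma card_tripleBridges (n : ℕ) : (tripleBridges n).card = (2 * n).choose n ^ 3 := by
  rw [tripleBridges, Fintype.card_piFinset_const, ← card_walksToZero_srw]
  simp

lemma swap_mem_walksToZero {n : ℕ} {x : Fin 3 → Fin (2 * n + 1) → ℤ} :
    Function.swap x ∈ walksToZero tripleSteps (2 * n) 0 ↔ x ∈ tripleBridges n := by
  simp only [mem_walksToZero, tripleBridges, Fintype.mem_piFinset, tripleSteps, funext_iff,
    Function.swap, Pi.sub_apply, Pi.zero_apply]
  grind

lemma card_filter_tripleBridges (n : ℕ) (P : (Fin (2 * n + 1) → Fin 3 → ℤ) → Prop)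
    [DecidablePred P] : Finset.card {x ∈ tripleBridges n | P (Function.swap x)} =
      Finset.card {x ∈ walksToZero tripleSteps (2 * n) 0 | P x} := by
  refine Finset.card_nbij' Function.swap Function.swap ?_ ?_ (fun _ _ => rfl) (fun _ _ => rfl)
  · intro x hx
    simpa [swap_mem_walksToZero] using hx
  · intro x hx
    simpa [← swap_mem_walksToZero] using hx

lemma card_walksToZero_triple (n : ℕ) :
    (walksToZero tripleSteps (2 * n) 0).card = (2 * n).choose n ^ 3 := by
  rw [← card_tripleBridges]
  simpa using (card_filter_tripleBridges n fun _ => True).symm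

lemma odd_of_mem_srwSteps {z : ℤ} (hz : z ∈ srwSteps) : Odd z := by
  rw [srwSteps, Finset.mem_insert, Finset.mem_singleton] at hz
  rcases hz with rfl | rfl <;> decide

/-- The first coordinate changes parity at each step. -/
lemma firstPassage_eq_zero_of_odd {m : ℕ} {g : Fin 3 → ℤ} (h : Odd (g 0 + m)) :
    firstPassage tripleSteps m g = 0 := by
  induction m generalizing g with
  | zero => rfl
  | succ m ih =>
    refine Finset.sum_eq_zero fun d hd => ?_
    have hd0 : Odd (d 0) := odd_of_mem_srwSteps (Fintype.mem_piFinset.1 hd 0)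
    push_cast at h
    split_ifs with h1 h2
    · have h3 : g 0 + d 0 = 0 := congrFun h1 0
      subst h2
      simp only [Nat.cast_zero, zero_add] at h
      grind
    · rfl
    · refine ih ?_
      rw [Pi.add_apply]
      grind

lemma even_add_of_mem_walksToZero {n : ℕ} {x : Fin (n + 1) → Fin 3 → ℤ} {g : Fin 3 → ℤ}
    (hg : g 0 = 0) (hx : x ∈ walksToZero tripleSteps n g) (j : Fin (n + 1)) :
    Even (x j 0 + (j : ℕ)) := by
  obtain ⟨h0, -, h⟩ := mem_walksToZero.1 hx
  induction j using Fin.induction with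
  | zero => simp [h0, hg]
  | succ i ih =>
    have hd : Odd (x i.succ 0 - x i.castSucc 0) :=
      odd_of_mem_srwSteps (Fintype.mem_piFinset.1 (h i) 0)
    simp only [Fin.val_castSucc, Fin.val_succ] at ih ⊢
    push_cast
    grind

/-- By parity the common zeros occur at even times, and time `0` is counted in `commonZeros` but
not in `visits`. -/
lemma card_commonZeros {n : ℕ} {x : Fin 3 → Fin (2 * n + 1) → ℤ} (hx : x ∈ tripleBridges n) :
    (commonZeros x).card = visits (Function.swap x) + 1 := by
  rw [commonZeros, Fin.card_filter_univ_succ, if_pos (Or.inl rfl), visits]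
  congr 1
  refine Finset.card_nbij (fun t => ⟨2 * t + 1, by omega⟩) ?_ ?_ ?_
  · intro t ht
    simp only [Finset.coe_filter, Finset.mem_univ, true_and,
      Set.mem_ofPred_eq, Fin.succ_ne_zero, false_or] at ht ⊢
    funext i
    exact ht i
  · intro s _ t _ hst
    simp only [Fin.mk.injEq] at hst
    ext
    omega
  · intro s hs
    simp only [Finset.coe_filter, Finset.mem_univ, true_and, Set.mem_ofPred_eq] at hs
    have h1 := even_add_of_mem_walksToZero rfl (swap_mem_walksToZero.2 hx) s.succ
    rw [hs] at h1
    simp only [Pi.zero_apply, zero_add, Fin.val_succ, Int.even_coe_nat] at h1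
    obtain ⟨r, hr⟩ := h1
    refine ⟨⟨r - 1, by omega⟩, ?_, ?_⟩
    · simp only [Finset.coe_filter, Finset.mem_univ, true_and,
        Set.mem_ofPred_eq, Fin.succ_ne_zero, false_or]
      intro i
      have h2 : x i s.succ = 0 := congrFun hs i
      rw [← h2]
      congr 1
      ext
      simp only [Fin.val_succ]
      omega
    · ext
      simp only
      omega

lemma threeBridgeMeasure_eq_uniformOn (n : ℕ) :
    threeBridgeMeasure n = ProbabilityTheory.uniformOn (tripleBridges n : Set _) := by
  refine Measure.ext_of_singleton fun x => ?_
  have h (x : Fin (2 * n + 1) → ℤ) : srwBridgeMeasure n {x} =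
      if x ∈ walksToZero srwSteps (2 * n) 0 then
        ((walksToZero srwSteps (2 * n) 0).card : ENNReal)⁻¹ else 0 := by
    rw [srwBridgeMeasure, ← coe_walksToZero_srw, ← Finset.coe_singleton,
      ProbabilityTheory.uniformOn_apply_finset]
    split_ifs with hx
    · rw [Finset.inter_singleton_of_mem hx, Finset.card_singleton, Nat.cast_one, one_div]
    · rw [Finset.inter_singleton_of_notMem hx]
      simp
  have : IsZeroOrProbabilityMeasure (srwBridgeMeasure n) := by
    unfold srwBridgeMeasure; infer_instance
  rw [threeBridgeMeasure, Measure.pi_singleton, ← Finset.coe_singleton,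
    ProbabilityTheory.uniformOn_apply_finset]
  simp only [h]
  by_cases hx : x ∈ tripleBridges n
  · have hx' := Fintype.mem_piFinset.1 hx
    rw [Finset.inter_singleton_of_mem hx, Finset.card_singleton, Nat.cast_one, one_div,
      tripleBridges, Fintype.card_piFinset_const]
    simp [hx', ENNReal.inv_pow]
  · rw [Finset.inter_singleton_of_notMem hx]
    rw [tripleBridges, Fintype.mem_piFinset] at hx
    push Not at hx
    obtain ⟨i, hi⟩ := hx
    rw [Finset.prod_eq_zero (Finset.mem_univ i) (if_neg hi)]
    simp

lemma threeBridgeMeasure_real_card_commonZeros (n k : ℕ) :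
    (threeBridgeMeasure n).real {x | (commonZeros x).card = k + 1} =
      (visitCount tripleSteps (2 * n) k : ℝ) / (((2 * n).choose n : ℕ) : ℝ) ^ 3 := by
  classical
  rw [threeBridgeMeasure_eq_uniformOn, Measure.real,
    ← ProbabilityTheory.uniformOn_inter_self (Finset.finite_toSet _)]
  have h : (tripleBridges n : Set (Fin 3 → Fin (2 * n + 1) → ℤ)) ∩
      {x | (commonZeros x).card = k + 1} =
      ({x ∈ tripleBridges n | visits (Function.swap x) = k} : Finset _) := by
    ext x
    simp only [Set.mem_inter_iff, Finset.mem_coe, Set.mem_ofPred_eq, Finset.mem_filter]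
    refine and_congr_right fun hx => ?_
    rw [card_commonZeros hx, Nat.add_right_cancel_iff]
  rw [h, ProbabilityTheory.uniformOn_apply_finset,
    Finset.inter_eq_right.2 (Finset.filter_subset _ _),
    card_filter_tripleBridges n fun x => visits x = k, card_tripleBridges, visitCount]
  simp

/-! ### The renewal structure of the common zeros -/

/-- The probability that `2 * n` is the first positive time at which three independent simple random
walks started at `0` are simultaneously at `0`; each step has `8` outcomes, whence `64 ^ n`. -/
noncomputable def tripleFirstReturn (n : ℕ) : ℝ :=
  (firstPassage tripleSteps (2 * n) 0 : ℝ) / 64 ^ n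

/-- By parity, only even first-passage times contribute. -/
lemma sum_antidiagonal_two_mul_firstPassage (F : ℕ → ℕ) (n : ℕ) :
    ∑ p ∈ Finset.HasAntidiagonal.antidiagonal (2 * n), firstPassage tripleSteps p.1 0 * F p.2 =
      ∑ p ∈ Finset.HasAntidiagonal.antidiagonal n,
        firstPassage tripleSteps (2 * p.1) 0 * F (2 * p.2) := by
  symm
  refine Finset.sum_of_injOn (fun p => (2 * p.1, 2 * p.2)) ?_ ?_ ?_ (fun _ _ => rfl)
  · rintro ⟨a, b⟩ _ ⟨c, d⟩ _ h
    simp only [Prod.mk.injEq] at h ⊢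
    omega
  · rintro ⟨a, b⟩ h
    simp only [Finset.mem_coe, Finset.HasAntidiagonal.mem_antidiagonal] at h ⊢
    omega
  · rintro ⟨a, b⟩ h h'
    rw [firstPassage_eq_zero_of_odd, zero_mul]
    simp only [Finset.HasAntidiagonal.mem_antidiagonal] at h
    by_contra ha
    rw [Pi.zero_apply, zero_add, Int.odd_coe_nat, Nat.not_odd_iff_even] at ha
    obtain ⟨r, hr⟩ := ha
    refine h' ⟨(r, n - r), ?_, ?_⟩
    · simp only [Finset.mem_coe, Finset.HasAntidiagonal.mem_antidiagonal]
      omega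
    · simp only [Prod.mk.injEq]
      omega

lemma card_walksToZero_triple_div (n : ℕ) :
    ((walksToZero tripleSteps (2 * n) 0).card : ℝ) / 64 ^ n = returnProb n ^ 3 := by
  rw [card_walksToZero_triple, Nat.cast_pow, choose_cube_eq]
  field_simp

lemma sum_div_pow_eq_seqConv {F : ℕ → ℕ} {v : ℕ → ℝ} (hv : ∀ n, (F (2 * n) : ℝ) / 64 ^ n = v n)
    (n : ℕ) : ((∑ p ∈ Finset.HasAntidiagonal.antidiagonal (2 * n),
      firstPassage tripleSteps p.1 0 * F p.2 : ℕ) : ℝ) / 64 ^ n =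
      seqConv tripleFirstReturn v n := by
  rw [sum_antidiagonal_two_mul_firstPassage, Nat.cast_sum, Finset.sum_div, seqConv]
  refine Finset.sum_congr rfl fun p hp => ?_
  rw [← hv, tripleFirstReturn, ← Finset.HasAntidiagonal.mem_antidiagonal.1 hp, pow_add,
    div_mul_div_comm, Nat.cast_mul]

/-- The `k` waiting times between successive common zeros are independent, so that the probability
of `k` visits is a convolution power. -/
lemma visitCount_div (k n : ℕ) : (visitCount tripleSteps (2 * n) k : ℝ) / 64 ^ n =
    seqConvPow tripleFirstReturn k n := by
  induction k generalizing n with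
  | zero =>
    rw [visitCount_zero_right]
    rcases n with _ | n <;> simp [seqConvPow]
  | succ k ih =>
    rw [visitCount_succ, sum_div_pow_eq_seqConv (F := fun m => visitCount tripleSteps m k) ih]
    rfl

theorem tripleFirstReturn_hasSum_and_tendsto {S : ℝ}
    (hS : HasSum (fun n => returnProb n ^ 3) S) :
    HasSum tripleFirstReturn (1 - 1 / S) ∧
      Tendsto (fun n => tripleFirstReturn n / cubicWeight n) atTop
        (𝓝 ((√Real.pi ^ 3)⁻¹ / S ^ 2)) := by
  refine isRegularWeight_cubicWeight.tendsto_of_renewal (by simp)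
    (fun n => pow_nonneg (returnProb_pos n).le 3) hS (hS.tsum_eq ▸ tsum_returnProb_cube_lt_two)
    tendsto_returnProb_cube_div (by simp [tripleFirstReturn, firstPassage])
    (fun n => by unfold tripleFirstReturn; positivity) (fun n => ?_) (fun n hn => ?_)
  · rw [← card_walksToZero_triple_div, tripleFirstReturn]
    gcongr
    exact firstPassage_le _ _
  · rw [← sum_div_pow_eq_seqConv (F := fun m => (walksToZero tripleSteps m 0).card)
      card_walksToZero_triple_div, ← card_walksToZero_eq _ (by omega), card_walksToZero_triple_div]

/-! ### The limit theorems -/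

theorem mainTheorem3 :
    (∀ k : ℕ, 1 ≤ k →
      (fun n : ℕ => multiConv k (fun j => (((2 * j).choose j : ℕ) : ℝ) ^ 3) n) ~[atTop]
        fun n : ℕ => (64 : ℝ) ^ n / ((n : ℝ) * Real.pi) ^ (3 / 2 : ℝ) *
          (Real.pi / Real.Gamma (3 / 4) ^ 4) ^ (k - 1) * (k : ℝ)) ∧
    ∀ p : ℝ, p = Real.Gamma (3 / 4) ^ 4 / Real.pi →
      0 < p ∧ p < 1 ∧
      ∀ k : ℕ, 2 ≤ k →
        Tendsto (fun n : ℕ => (threeBridgeMeasure n).real {x | (commonZeros x).card = k})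
          atTop (𝓝 (((k : ℝ) - 1) * (1 - p) ^ (k - 2) * p ^ 2)) := by
  refine ⟨fun k hk => multiConv_choose_cube_isEquivalent hk, fun p hp => ?_⟩
  have hpS : Real.pi / Real.Gamma (3 / 4) ^ 4 = p⁻¹ := by rw [hp, inv_div]
  have hsum := hasSum_returnProb_cube
  rw [hpS] at hsum
  have hp1 : 1 < p⁻¹ := hsum.tsum_eq ▸ one_lt_tsum_returnProb_cube
  have hp0 : 0 < p := inv_pos.1 (by linarith)
  refine ⟨hp0, (one_lt_inv₀ hp0).1 hp1, fun k hk => ?_⟩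
  obtain ⟨m, rfl⟩ : ∃ m, k = m + 2 := ⟨k - 2, by omega⟩
  obtain ⟨hF, hf⟩ := tripleFirstReturn_hasSum_and_tendsto hsum
  have hpi : 0 < √Real.pi := Real.sqrt_pos.2 Real.pi_pos
  -- `m + 2` common zeros, time `0` included, amount to `m + 1` waiting times.
  have h := (isRegularWeight_cubicWeight.tendsto_seqConvPow hF hf (m + 1)).div
    tendsto_returnProb_cube_div (by positivity)
  convert! h using 2 with n
  · have h1 := returnProb_pos n
    have h2 := isRegularWeight_cubicWeight.pos n
    rw [threeBridgeMeasure_real_card_commonZeros n (m + 1), choose_cube_eq, Pi.div_apply,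
      ← visitCount_div]
    field_simp
  · simp only [Nat.add_sub_cancel]
    push_cast
    field_simp
    ring
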